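/- **Market of factors.** Let $(\Omega,\mathcal F,(\mathcal F_\tau)_{\tau\ge\tau_0},P)$ be a filtered probability space satisfying the usual conditions, and let $W^1,\dots,W^n$ be independent Brownian motions with respect to this filtration. A market of factors consists of nonnegative processes $S^1,\dots,S^n$ with $S^k_{\tau_0}>0$ and $$\frac{dS^k_\tau}{S^k_\tau}=\hat\lambda_\tau\,d\tau+\beta^k_\tau\left(\beta^k_\tau\,\omega^k\,d\tau+dW^k_\tau\right),\qquad k=1,\dots,n,\ \tau\ge\tau_0,$$ where the volatilities $\beta^k$ are strictly positive, continuous and adapted, the risk premium parameters $\omega^k>0$ are constants, and $\hat\lambda$ is progressively measurable with $\int_{\tau_0}^{\tau}\hat\lambda_s^2\,ds<\infty$ almost surely for all $\tau$. Write $\omega=(\omega^1,\dots,\omega^n)^\top$, $\mathbf W=(W^1,\dots,W^n)^\top$, $\mathbf 1=(1,\dots,1)^\top$ and $\beta_\tau=\mathrm{diag}(\beta^1_\tau,\dots,\beta^n_\tau)$. The instantaneous growth rate (the drift of the logarithm) of a portfolio of factors with weight vector $\pi$ is $$g^\pi_\tau=\pi^\top\left(\hat\lambda_\tau\mathbf 1+\beta_\tau\beta_\tau\omega\right)-\tfrac12\,\pi^\top\beta_\tau\beta_\tau\pi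 ,$$ which equals $\hat\lambda_\tau+\pi^\top\beta_\tau\beta_\tau(\omega-\frac12\pi)$ when $\pi^\top\mathbf 1=1$. The process $\hat\lambda$ is the *net risk-adjusted return* of the market, that is, by definition, the Lagrange multiplier of the problem $$\max\{g^\pi_\tau \mid \pi\in\mathbf R^n,\ \pi^\top\mathbf 1=1\}:\qquad(*)$$ almost surely, for almost every $\tau$, problem $(*)$ has a solution at which the gradient in $\pi$ of $g^\pi_\tau-\hat\lambda_\tau(\pi^\top\mathbf 1-1)$ vanishes. A *benchmark* (growth optimal portfolio) is a strictly positive self-financing portfolio of factors $S^*$, that is, $S^*=\sum_k\delta^kS^k$ and $dS^*=\sum_k\delta^k\,dS^k$ for some progressively measurable holdings $\delta^k$, whose weights $\pi^{*,k}_\tau=\delta^k_\tau S^k_\tau/S^*_\tau$ solve $(*)$ for all $\tau\ge\tau_0$, almost surely. **Theorem.** In every market of factors, the following hold. 1. The risk premium parameters sum to one: $\omega^\top\mathbf 1=1$. 2. For every $\tau\ge\tau_0$ and every outcome, $\omega$ is the unique solution of $(*)$. Hence every benchmark has the weights $\pi^*_\tau=\omega$ for all $\tau\ge\tau_0$, almost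 surely. 3. Every benchmark $S^*$ satisfies $S^*_{\tau_0}>0$ almost surely and $$\frac{dS^*_\tau}{S^*_\tau}=\hat\lambda_\tau\,d\tau+(\beta_\tau\omega)^\top\left(\beta_\tau\omega\,d\tau+d\mathbf W_\tau\right),\qquad \tau\ge\tau_0.$$ -/

import Mathlib

open MeasureTheory ProbabilityTheory Filter Topology
open scoped ENNReal NNReal Matrix

noncomputable section

namespace FactorMarket

/-! ### Market time, filtration, driving Brownian motions -/

/-- Market times `τ ∈ [τ₀, ∞)`, where `τ₀` is the initial market time. -/
abbrev Time (τ₀ : ℝ) : Type := Set.Ici τ₀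

/-- Lebesgue measure on `[τ₀, ∞)`. -/
def timeMeasure (τ₀ : ℝ) : Measure (Time τ₀) := (volume : Measure ℝ).comap Subtype.val

/-- The usual conditions: right-continuity, and every `P`-null set lies in the initial
σ-algebra (so that the probability space is complete as well). -/
structure UsualConditions {Ω : Type*} {mΩ : MeasurableSpace Ω} {τ₀ : ℝ}
    (P : Measure Ω) (𝓕 : Filtration (Time τ₀) mΩ) : Prop where
  rightContinuous : 𝓕.IsRightContinuous
  complete : ∀ N : Set Ω, P N = 0 → MeasurableSet[𝓕 ⊥] N

/-- `W¹, …, Wⁿ` are independent Brownian motions in market time, started at time `τ₀`, with respect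
to the filtration `𝓕`. -/
structure IsBrownianFamily {Ω : Type*} {mΩ : MeasurableSpace Ω} {τ₀ : ℝ} {n : ℕ}
    (P : Measure Ω) (𝓕 : Filtration (Time τ₀) mΩ) (W : Fin n → Time τ₀ → Ω → ℝ) : Prop where
  brownian : ∀ k, IsBrownianReal
    (fun (u : ℝ≥0) ω => W k ⟨τ₀ + (u : ℝ), le_add_of_nonneg_right u.2⟩ ω) P
  independent : iIndepFun (fun k ω t => W k t ω) P
  adapted : ∀ k, StronglyAdapted 𝓕 (W k)
  incrementsIndependent : ∀ s t : Time τ₀, s ≤ t →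
    Indep (MeasurableSpace.comap (fun ω k => W k t ω - W k s ω) MeasurableSpace.pi) (𝓕 s) P

/-! ### The Itô integral and Itô processes -/

/-- Simple predictable processes: finite sums `∑ᵢ ξᵢ 1_{(lᵢ, rᵢ]}` with bounded
`𝓕_{lᵢ}`-measurable `ξᵢ`. -/
structure SimpleProcess {Ω : Type*} {mΩ : MeasurableSpace Ω} {τ₀ : ℝ}
    (𝓕 : Filtration (Time τ₀) mΩ) where
  num : ℕ
  left : Fin num → Time τ₀
  right : Fin num → Time τ₀
  left_le_right : ∀ i, left i ≤ right i
  coef : Fin num → Ω → ℝ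
  measurable_coef : ∀ i, StronglyMeasurable[𝓕 (left i)] (coef i)
  bounded_coef : ∃ C : ℝ, ∀ i ω, |coef i ω| ≤ C

/-- The process `∑ᵢ ξᵢ 1_{(lᵢ, rᵢ]}(t)`. -/
def SimpleProcess.value {Ω : Type*} {mΩ : MeasurableSpace Ω} {τ₀ : ℝ}
    {𝓕 : Filtration (Time τ₀) mΩ} (J : SimpleProcess 𝓕) (t : Time τ₀) (ω : Ω) : ℝ :=
  ∑ i, (Set.Ioc (J.left i) (J.right i)).indicator (fun _ => J.coef i ω) t

/-- The elementary stochastic integral `∑ᵢ ξᵢ (W_{rᵢ ∧ t} - W_{lᵢ ∧ t})`. -/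
def SimpleProcess.integral {Ω : Type*} {mΩ : MeasurableSpace Ω} {τ₀ : ℝ}
    {𝓕 : Filtration (Time τ₀) mΩ} (J : SimpleProcess 𝓕) (W : Time τ₀ → Ω → ℝ)
    (t : Time τ₀) (ω : Ω) : ℝ :=
  ∑ i, J.coef i ω * (W (min (J.right i) t) ω - W (min (J.left i) t) ω)

/-- `I` is the Itô integral process `I_t = ∫_{τ₀}^t H_s dW_s`: the integrand `H` is progressive
with almost surely `∫_{τ₀}^t H_s² ds < ∞`, and `I` is the continuous adapted process which at
every time is the limit in probability of the elementary integrals of simple processes `J m` with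
`∫_{τ₀}^t (J m - H)² ds → 0` in probability. -/
structure IsItoIntegral {Ω : Type*} {mΩ : MeasurableSpace Ω} {τ₀ : ℝ}
    (P : Measure Ω) (𝓕 : Filtration (Time τ₀) mΩ)
    (W H I : Time τ₀ → Ω → ℝ) : Prop where
  progressive : IsStronglyProgressive 𝓕 H
  squareIntegrable : ∀ᵐ ω ∂P, ∀ t : Time τ₀,
    IntegrableOn (fun s => H s ω ^ 2) (Set.Iic t) (timeMeasure τ₀)
  adapted : StronglyAdapted 𝓕 I
  continuous : ∀ ω, Continuous fun t => I t ω
  approx : ∃ J : ℕ → SimpleProcess 𝓕, ∀ t : Time τ₀,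
    (∀ ε : ℝ≥0∞, 0 < ε → Tendsto (fun m => P {ω | ε ≤
      ∫⁻ s in Set.Iic t, ‖(J m).value s ω - H s ω‖ₑ ^ 2 ∂(timeMeasure τ₀)}) atTop (𝓝 0)) ∧
    TendstoInMeasure P (fun m => (J m).integral W t) atTop (I t)

/-- `X` is a continuous adapted process with stochastic differential
`dX = a dτ + ∑ⱼ bʲ dWʲ`, that is, almost surely
`X_t = X_{τ₀} + ∫_{τ₀}^t a_s ds + ∑ⱼ ∫_{τ₀}^t bʲ_s dWʲ_s` for all `t`, all integrals existing. -/
structure HasItoDifferential {Ω : Type*} {mΩ : MeasurableSpace Ω} {τ₀ : ℝ} {n : ℕ}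
    (P : Measure Ω) (𝓕 : Filtration (Time τ₀) mΩ) (W : Fin n → Time τ₀ → Ω → ℝ)
    (X a : Time τ₀ → Ω → ℝ) (b : Fin n → Time τ₀ → Ω → ℝ) : Prop where
  adapted : StronglyAdapted 𝓕 X
  continuous : ∀ ω, Continuous fun t => X t ω
  driftProgressive : IsStronglyProgressive 𝓕 a
  driftIntegrable : ∀ᵐ ω ∂P, ∀ t : Time τ₀,
    IntegrableOn (fun s => a s ω) (Set.Iic t) (timeMeasure τ₀)
  eq_integral : ∃ I : Fin n → Time τ₀ → Ω → ℝ,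
    (∀ j, IsItoIntegral P 𝓕 (W j) (b j) (I j)) ∧
    ∀ᵐ ω ∂P, ∀ t : Time τ₀,
      X t ω = X ⊥ ω + ∫ s in Set.Iic t, a s ω ∂(timeMeasure τ₀) + ∑ j, I j t ω

/-- `dX / X = a dτ + ∑ⱼ bʲ dWʲ`, that is, `dX = X a dτ + ∑ⱼ X bʲ dWʲ`. -/
def HasRelativeDifferential {Ω : Type*} {mΩ : MeasurableSpace Ω} {τ₀ : ℝ} {n : ℕ}
    (P : Measure Ω) (𝓕 : Filtration (Time τ₀) mΩ) (W : Fin n → Time τ₀ → Ω → ℝ)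
    (X a : Time τ₀ → Ω → ℝ) (b : Fin n → Time τ₀ → Ω → ℝ) : Prop :=
  HasItoDifferential P 𝓕 W X (fun t ω => X t ω * a t ω) (fun j t ω => X t ω * b j t ω)

/-! ### Growth rates and their constrained maximization -/

/-- The instantaneous growth rate `πᵀ a - ½ |bᵀ π|²` (the drift of the logarithm) of a portfolio
with weight vector `π`, `dS^π / S^π = πᵀ (a dτ + b dW)`, when `a` is the vector of the rates of
return of the securities and `b` is their volatility matrix. -/
def growthRate {n : ℕ} (a : Fin n → ℝ) (b : Matrix (Fin n) (Fin n) ℝ) (p : Fin n → ℝ) : ℝ :=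
  p ⬝ᵥ a - 1 / 2 * ((bᵀ *ᵥ p) ⬝ᵥ (bᵀ *ᵥ p))

/-- `p` solves `max {g(π) | π ∈ ℝⁿ, πᵀ 1 = 1}`. -/
def IsConstrainedMaximizer {n : ℕ} (g : (Fin n → ℝ) → ℝ) (p : Fin n → ℝ) : Prop :=
  ∑ k, p k = 1 ∧ ∀ q : Fin n → ℝ, ∑ k, q k = 1 → g q ≤ g p

/-- `l` is the Lagrange multiplier of `max {g(π) | π ∈ ℝⁿ, πᵀ 1 = 1}`: the problem has a solution
at which the Lagrangian `g(π) - l (πᵀ 1 - 1)` is stationary in `π`. -/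
def IsLagrangeMultiplier {n : ℕ} (g : (Fin n → ℝ) → ℝ) (l : ℝ) : Prop :=
  ∃ p : Fin n → ℝ, IsConstrainedMaximizer g p ∧
    HasFDerivAt (fun q : Fin n → ℝ => g q - l * (∑ k, q k - 1))
      (0 : (Fin n → ℝ) →L[ℝ] ℝ) p

/-! ### The market of factors -/

/-- The diagonal matrix `β_τ` of the factor volatilities. -/
def volMatrix {Ω : Type*} {τ₀ : ℝ} {n : ℕ} (β : Fin n → Time τ₀ → Ω → ℝ)
    (t : Time τ₀) (ω : Ω) : Matrix (Fin n) (Fin n) ℝ :=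
  Matrix.diagonal fun k => β k t ω

/-- The vector of the rates of return `λ̂ + βᵏ βᵏ ωᵏ` of the factors, where `w = (ω¹, …, ωⁿ)`. -/
def rateOfReturn {Ω : Type*} {τ₀ : ℝ} {n : ℕ} (lam : Time τ₀ → Ω → ℝ)
    (β : Fin n → Time τ₀ → Ω → ℝ) (w : Fin n → ℝ) (t : Time τ₀) (ω : Ω) : Fin n → ℝ :=
  fun k => lam t ω + β k t ω * (β k t ω * w k)

/-- The instantaneous growth rate at market time `t` of a portfolio of factors with weights `p`. -/
def factorGrowthRate {Ω : Type*} {τ₀ : ℝ} {n : ℕ} (lam : Time τ₀ → Ω → ℝ)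
    (β : Fin n → Time τ₀ → Ω → ℝ) (w : Fin n → ℝ) (t : Time τ₀) (ω : Ω)
    (p : Fin n → ℝ) : ℝ :=
  growthRate (rateOfReturn lam β w t ω) (volMatrix β t ω) p

/-- The market of factors `S¹, …, Sⁿ`, driven by independent Brownian motions `W¹, …, Wⁿ`, with
net risk-adjusted return `lam` (`λ̂`), factor volatilities `β¹, …, βⁿ` and constant risk premium
parameters `w = (ω¹, …, ωⁿ)`. -/
structure IsFactorMarket {Ω : Type*} {mΩ : MeasurableSpace Ω} {τ₀ : ℝ} {n : ℕ}
    (P : Measure Ω) (𝓕 : Filtration (Time τ₀) mΩ)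
    (S W : Fin n → Time τ₀ → Ω → ℝ) (lam : Time τ₀ → Ω → ℝ)
    (β : Fin n → Time τ₀ → Ω → ℝ) (w : Fin n → ℝ) : Prop where
  usual : UsualConditions P 𝓕
  brownian : IsBrownianFamily P 𝓕 W
  lam_progressive : IsStronglyProgressive 𝓕 lam
  lam_squareIntegrable : ∀ᵐ ω ∂P, ∀ t : Time τ₀,
    IntegrableOn (fun s => lam s ω ^ 2) (Set.Iic t) (timeMeasure τ₀)
  vol_adapted : ∀ k, StronglyAdapted 𝓕 (β k)
  vol_continuous : ∀ k ω, Continuous fun t => β k t ω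
  vol_pos : ∀ k t ω, 0 < β k t ω
  premium_pos : ∀ k, 0 < w k
  factor_nonneg : ∀ k, ∀ᵐ ω ∂P, ∀ t, 0 ≤ S k t ω
  factor_initial_pos : ∀ k, ∀ᵐ ω ∂P, 0 < S k ⊥ ω
  /-- `dSᵏ / Sᵏ = λ̂ dτ + βᵏ (βᵏ ωᵏ dτ + dWᵏ)`. -/
  factor_sde : ∀ k, HasRelativeDifferential P 𝓕 W (S k)
    (fun t ω => rateOfReturn lam β w t ω k) (fun j t ω => volMatrix β t ω k j)
  /-- The definition of the net risk-adjusted return: `λ̂` is the Lagrange multiplier of the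
  maximization of the growth rate over the portfolios of factors. -/
  lam_multiplier : ∀ᵐ ω ∂P, ∀ᵐ t ∂(timeMeasure τ₀),
    IsLagrangeMultiplier (factorGrowthRate lam β w t ω) (lam t ω)

/-- `V` is a strictly positive self-financing portfolio of factors with weight vector `p`: for
some numbers `δᵏ` of units held, `V = ∑ₖ δᵏ Sᵏ`, `dV = ∑ₖ δᵏ dSᵏ` and `pᵏ = δᵏ Sᵏ / V`. -/
structure IsPortfolio {Ω : Type*} {mΩ : MeasurableSpace Ω} {τ₀ : ℝ} {n : ℕ}
    (P : Measure Ω) (𝓕 : Filtration (Time τ₀) mΩ)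
    (S W : Fin n → Time τ₀ → Ω → ℝ) (lam : Time τ₀ → Ω → ℝ)
    (β : Fin n → Time τ₀ → Ω → ℝ) (w : Fin n → ℝ)
    (V : Time τ₀ → Ω → ℝ) (p : Fin n → Time τ₀ → Ω → ℝ) : Prop where
  pos : ∀ᵐ ω ∂P, ∀ t, 0 < V t ω
  holdings : ∃ δ : Fin n → Time τ₀ → Ω → ℝ,
    (∀ k, IsStronglyProgressive 𝓕 (δ k)) ∧
    (∀ᵐ ω ∂P, ∀ t, V t ω = ∑ k, δ k t ω * S k t ω) ∧
    (∀ᵐ ω ∂P, ∀ t k, p k t ω = δ k t ω * S k t ω / V t ω) ∧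
    HasItoDifferential P 𝓕 W V
      (fun t ω => ∑ k, δ k t ω * (S k t ω * rateOfReturn lam β w t ω k))
      (fun j t ω => ∑ k, δ k t ω * (S k t ω * volMatrix β t ω k j))

/-- `V` is a benchmark (growth optimal portfolio of factors) with weight vector `p`: a strictly
positive portfolio of factors whose weights at all market times solve
`max {g^π | π ∈ ℝⁿ, πᵀ 1 = 1}`. -/
structure IsBenchmark {Ω : Type*} {mΩ : MeasurableSpace Ω} {τ₀ : ℝ} {n : ℕ}
    (P : Measure Ω) (𝓕 : Filtration (Time τ₀) mΩ)
    (S W : Fin n → Time τ₀ → Ω → ℝ) (lam : Time τ₀ → Ω → ℝ)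
    (β : Fin n → Time τ₀ → Ω → ℝ) (w : Fin n → ℝ)
    (V : Time τ₀ → Ω → ℝ) (p : Fin n → Time τ₀ → Ω → ℝ) : Prop where
  portfolio : IsPortfolio P 𝓕 S W lam β w V p
  optimal : ∀ᵐ ω ∂P, ∀ t,
    IsConstrainedMaximizer (factorGrowthRate lam β w t ω) (fun k => p k t ω)

end FactorMarket

end

namespace FactorMarket

variable {Ω : Type*} {mΩ : MeasurableSpace Ω} {P : Measure Ω} {τ₀ : ℝ}
  {𝓕 : Filtration (Time τ₀) mΩ} {n : ℕ}

/-! Completing the square writes the growth rate of weights `p` as `λ̂ ∑ pᵏ + ½ ∑ (βᵏ ωᵏ)² - ½ ∑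
(βᵏ)² (pᵏ - ωᵏ)²` (`factorGrowthRate_eq_sub`). Subtracting `λ̂ (∑ pᵏ - 1)` removes the linear term
exactly because the multiplier is the same `λ̂` that appears in the drifts, so `ω` is the only
critical point of the Lagrangian. The critical point provided by the multiplier condition satisfies
the constraint, hence `∑ ωᵏ = 1`; as `ω` is constant, one time and one outcome suffice. Given this,
the square shows that `ω` is the unique maximizer wherever all `βᵏ > 0`.

A benchmark therefore invests the amounts `δᵏ Sᵏ = V ωᵏ`. Substituting them into the self-financing
equation gives the stated differential, since coefficients may be replaced by indistinguishable
progressive ones (`HasItoDifferential.congr_coeff`). -/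

/-- `[τ₀, ∞)` has positive Lebesgue measure. -/
instance timeMeasure_neZero (τ₀ : ℝ) : NeZero (timeMeasure τ₀) := by
  refine ⟨fun h => ?_⟩
  have h1 : timeMeasure τ₀ Set.univ = ∞ := by
    rw [timeMeasure, comap_subtype_coe_apply measurableSet_Ici, Set.image_univ,
      Subtype.range_coe, Real.volume_Ici]
  simp [h] at h1

/-- The growth rate in coordinates. -/
theorem factorGrowthRate_eq (lam : Time τ₀ → Ω → ℝ) (β : Fin n → Time τ₀ → Ω → ℝ)
    (w : Fin n → ℝ) (t : Time τ₀) (ω : Ω) (p : Fin n → ℝ) :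
    factorGrowthRate lam β w t ω p =
      ∑ k, (p k * (lam t ω + β k t ω ^ 2 * w k) - 1 / 2 * (β k t ω ^ 2 * p k ^ 2)) := by
  simp only [factorGrowthRate, growthRate, rateOfReturn, volMatrix, Matrix.diagonal_transpose,
    Matrix.mulVec_diagonal, dotProduct, Finset.mul_sum, ← Finset.sum_sub_distrib]
  exact Finset.sum_congr rfl fun k _ => by ring

/-- Completing the square in the growth rate. -/
theorem factorGrowthRate_eq_sub (lam : Time τ₀ → Ω → ℝ) (β : Fin n → Time τ₀ → Ω → ℝ)
    (w : Fin n → ℝ) (t : Time τ₀) (ω : Ω) (p : Fin n → ℝ) :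
    factorGrowthRate lam β w t ω p =
      lam t ω * ∑ k, p k + 1 / 2 * ∑ k, β k t ω ^ 2 * w k ^ 2
        - 1 / 2 * ∑ k, β k t ω ^ 2 * (p k - w k) ^ 2 := by
  rw [factorGrowthRate_eq]
  simp only [Finset.mul_sum, ← Finset.sum_sub_distrib, ← Finset.sum_add_distrib]
  exact Finset.sum_congr rfl fun k _ => by ring

/-- If `λ̂` is the Lagrange multiplier at one time and outcome, then the risk premium parameters
sum to one. -/
theorem sum_premium_of_isLagrangeMultiplier {lam : Time τ₀ → Ω → ℝ}
    {β : Fin n → Time τ₀ → Ω → ℝ} {w : Fin n → ℝ} {t : Time τ₀} {ω : Ω}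
    (hβ : ∀ k, 0 < β k t ω)
    (h : IsLagrangeMultiplier (factorGrowthRate lam β w t ω) (lam t ω)) :
    ∑ k, w k = 1 := by
  obtain ⟨p, ⟨hp, -⟩, hd⟩ := h
  -- The Lagrangian is stationary in every direction, not only along the constraint, so each
  -- coordinate of `p` can be tested separately by moving along the `k`-th basis vector.
  suffices hpw : p = w by rwa [hpw] at hp
  funext k
  have hline : HasDerivAt (fun x : ℝ => p + x • (Pi.single k 1 : Fin n → ℝ)) (Pi.single k 1) 0 := by
    simpa using ((hasDerivAt_id (0 : ℝ)).smul_const (Pi.single k 1 : Fin n → ℝ)).const_add p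
  have hd0 : HasDerivAt (fun x : ℝ => factorGrowthRate lam β w t ω (p + x • Pi.single k 1)
      - lam t ω * (∑ i, (p + x • (Pi.single k 1 : Fin n → ℝ)) i - 1)) 0 0 := by
    have := HasFDerivAt.comp_hasDerivAt (x := (0 : ℝ))
      (f := fun x : ℝ => p + x • (Pi.single k 1 : Fin n → ℝ)) (l := fun q : Fin n → ℝ =>
        factorGrowthRate lam β w t ω q - lam t ω * (∑ k, q k - 1)) (l' := 0)
      (by simpa using hd) hline
    simpa [Function.comp_def] using this
  have hd1 : HasDerivAt (fun x : ℝ => factorGrowthRate lam β w t ω (p + x • Pi.single k 1)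
      - lam t ω * (∑ i, (p + x • (Pi.single k 1 : Fin n → ℝ)) i - 1))
      (-(β k t ω ^ 2 * (p k - w k))) 0 := by
    have hterm : ∀ i, HasDerivAt (fun x : ℝ =>
        β i t ω ^ 2 * (p i + x * (Pi.single k 1 : Fin n → ℝ) i - w i) ^ 2)
        (β i t ω ^ 2 * (2 * (p i - w i) * (Pi.single k 1 : Fin n → ℝ) i)) 0 := fun i => by
      have h1 := ((((hasDerivAt_id (0 : ℝ)).mul_const
        ((Pi.single k 1 : Fin n → ℝ) i)).const_add (p i)).sub_const (w i)).pow 2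
      simpa using h1.const_mul (β i t ω ^ 2)
    have hsum := ((HasDerivAt.fun_sum fun i (_ : i ∈ Finset.univ) => hterm i).const_mul
      (1 / 2 : ℝ)).const_sub (lam t ω + 1 / 2 * ∑ i, β i t ω ^ 2 * w i ^ 2)
    -- Along the line the terms `λ̂ ∑ pᵏ` cancel, leaving a constant minus a weighted sum of
    -- squares.
    have hfun (x : ℝ) : factorGrowthRate lam β w t ω (p + x • Pi.single k 1)
        - lam t ω * (∑ i, (p + x • (Pi.single k 1 : Fin n → ℝ)) i - 1) =
        lam t ω + 1 / 2 * ∑ i, β i t ω ^ 2 * w i ^ 2 -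
          1 / 2 * ∑ i, β i t ω ^ 2 * (p i + x * (Pi.single k 1 : Fin n → ℝ) i - w i) ^ 2 := by
      rw [factorGrowthRate_eq_sub]
      simp only [Pi.add_apply, Pi.smul_apply, smul_eq_mul]
      ring
    rw [funext hfun]
    refine hsum.congr_deriv ?_
    simp only [Pi.single_apply, mul_ite, mul_one, mul_zero, Finset.sum_ite_eq', Finset.mem_univ,
      if_true]
    ring
  have hz := hd0.unique hd1
  have hb := (pow_pos (hβ k) 2).ne'
  have : p k - w k = 0 := by
    rcases mul_eq_zero.1 (neg_eq_zero.1 hz.symm) with h | h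
    · exact absurd h hb
    · exact h
  linarith

/-- If the risk premium parameters sum to one, they are the unique growth optimal weights. -/
theorem isConstrainedMaximizer_iff {lam : Time τ₀ → Ω → ℝ} {β : Fin n → Time τ₀ → Ω → ℝ}
    {w : Fin n → ℝ} {t : Time τ₀} {ω : Ω} (hβ : ∀ k, 0 < β k t ω) (hw : ∑ k, w k = 1)
    {p : Fin n → ℝ} :
    IsConstrainedMaximizer (factorGrowthRate lam β w t ω) p ↔ p = w := by
  have hnonneg (q : Fin n → ℝ) (k : Fin n) (_ : k ∈ Finset.univ) :
      0 ≤ β k t ω ^ 2 * (q k - w k) ^ 2 := by positivity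
  constructor
  · rintro ⟨hp, hmax⟩
    -- Comparing with the competitor `w`, whose square term is zero, forces the square term of `p`
    -- to be at most zero.
    have h1 := hmax w hw
    rw [factorGrowthRate_eq_sub, factorGrowthRate_eq_sub, hp, hw] at h1
    simp only [sub_self, ne_eq, OfNat.ofNat_ne_zero, not_false_eq_true, zero_pow, mul_zero,
      Finset.sum_const_zero] at h1
    have h2 : ∑ k, β k t ω ^ 2 * (p k - w k) ^ 2 = 0 :=
      le_antisymm (by linarith) (Finset.sum_nonneg (hnonneg p))
    funext k
    have h3 := (Finset.sum_eq_zero_iff_of_nonneg (hnonneg p)).1 h2 k (Finset.mem_univ k)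
    rcases mul_eq_zero.1 h3 with h | h
    · exact absurd h (pow_pos (hβ k) 2).ne'
    · exact sub_eq_zero.1 (pow_eq_zero_iff two_ne_zero |>.1 h)
  · rintro rfl
    refine ⟨hw, fun q hq => ?_⟩
    rw [factorGrowthRate_eq_sub, factorGrowthRate_eq_sub, hq, hw]
    have := Finset.sum_nonneg (hnonneg q)
    simp only [sub_self, ne_eq, OfNat.ofNat_ne_zero, not_false_eq_true, zero_pow, mul_zero,
      Finset.sum_const_zero]
    linarith

/-- The Itô integral does not change under an indistinguishable change of the integrand. -/
theorem IsItoIntegral.congr_integrand {W H H' I : Time τ₀ → Ω → ℝ}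
    (h : IsItoIntegral P 𝓕 W H I) (hH' : IsStronglyProgressive 𝓕 H')
    (heq : ∀ᵐ ω ∂P, ∀ t, H t ω = H' t ω) : IsItoIntegral P 𝓕 W H' I where
  progressive := hH'
  squareIntegrable := by
    filter_upwards [h.squareIntegrable, heq] with ω h1 h2 t
    simpa only [h2] using h1 t
  adapted := h.adapted
  continuous := h.continuous
  approx := by
    obtain ⟨J, hJ⟩ := h.approx
    refine ⟨J, fun t => ⟨fun ε hε => ?_, (hJ t).2⟩⟩
    -- The same simple processes still approximate: the events measuring their distance to the
    -- integrand change only by null sets.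
    refine ((hJ t).1 ε hε).congr fun m => measure_congr (eventuallyEq_set.2 ?_)
    filter_upwards [heq] with ω h2
    simp only [h2]

/-- A stochastic differential does not change under indistinguishable changes of its
coefficients. -/
theorem HasItoDifferential.congr_coeff {W : Fin n → Time τ₀ → Ω → ℝ} {X a a' : Time τ₀ → Ω → ℝ}
    {b b' : Fin n → Time τ₀ → Ω → ℝ} (h : HasItoDifferential P 𝓕 W X a b)
    (ha' : IsStronglyProgressive 𝓕 a') (hb' : ∀ j, IsStronglyProgressive 𝓕 (b' j))
    (ha : ∀ᵐ ω ∂P, ∀ t, a t ω = a' t ω) (hb : ∀ᵐ ω ∂P, ∀ t j, b j t ω = b' j t ω) :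
    HasItoDifferential P 𝓕 W X a' b' where
  adapted := h.adapted
  continuous := h.continuous
  driftProgressive := ha'
  driftIntegrable := by
    filter_upwards [h.driftIntegrable, ha] with ω h1 h2 t
    simpa only [h2] using h1 t
  eq_integral := by
    obtain ⟨I, hI, hX⟩ := h.eq_integral
    refine ⟨I, fun j => (hI j).congr_integrand (hb' j) (hb.mono fun ω h t => h t j), ?_⟩
    filter_upwards [hX, ha] with ω h1 h2 t
    simpa only [h2] using h1 t

end FactorMarket

theorem mainTheorem4 {Ω : Type*} [mΩ : MeasurableSpace Ω] (P : Measure Ω) [IsProbabilityMeasure P]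
    (τ₀ : ℝ) (𝓕 : Filtration (FactorMarket.Time τ₀) mΩ) (n : ℕ)
    (S W : Fin n → FactorMarket.Time τ₀ → Ω → ℝ) (lam : FactorMarket.Time τ₀ → Ω → ℝ)
    (β : Fin n → FactorMarket.Time τ₀ → Ω → ℝ) (w : Fin n → ℝ)
    (hM : FactorMarket.IsFactorMarket P 𝓕 S W lam β w) :
    ∑ k, w k = 1 ∧
    (∀ (t : FactorMarket.Time τ₀) (ω : Ω) (p : Fin n → ℝ),
      FactorMarket.IsConstrainedMaximizer (FactorMarket.factorGrowthRate lam β w t ω) p ↔ p = w) ∧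
    ∀ (V : FactorMarket.Time τ₀ → Ω → ℝ) (p : Fin n → FactorMarket.Time τ₀ → Ω → ℝ),
      FactorMarket.IsBenchmark P 𝓕 S W lam β w V p →
        (∀ᵐ ω ∂P, ∀ t k, p k t ω = w k) ∧
        (∀ᵐ ω ∂P, 0 < V ⊥ ω) ∧
        FactorMarket.HasRelativeDifferential P 𝓕 W V
          (fun t ω => lam t ω +
            (FactorMarket.volMatrix β t ω *ᵥ w) ⬝ᵥ (FactorMarket.volMatrix β t ω *ᵥ w))
          (fun k t ω => (FactorMarket.volMatrix β t ω *ᵥ w) k) := by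
  have hw : ∑ k, w k = 1 := by
    -- Neither `P` nor `timeMeasure τ₀` is the zero measure, so the almost-everywhere condition
    -- holds at some outcome and time.
    obtain ⟨ω, hω⟩ := hM.lam_multiplier.exists
    obtain ⟨t, ht⟩ := hω.exists
    exact FactorMarket.sum_premium_of_isLagrangeMultiplier (fun k => hM.vol_pos k t ω) ht
  have hiff (t : FactorMarket.Time τ₀) (ω : Ω) (p : Fin n → ℝ) :
      FactorMarket.IsConstrainedMaximizer (FactorMarket.factorGrowthRate lam β w t ω) p ↔ p = w :=
    FactorMarket.isConstrainedMaximizer_iff (fun k => hM.vol_pos k t ω) hw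
  refine ⟨hw, hiff, fun V p hV => ?_⟩
  have hp : ∀ᵐ ω ∂P, ∀ t k, p k t ω = w k := by
    filter_upwards [hV.optimal] with ω h t k
    exact congrFun ((hiff t ω _).1 (h t)) k
  refine ⟨hp, hV.portfolio.pos.mono fun ω h => h ⊥, ?_⟩
  obtain ⟨δ, -, -, hδp, hdV⟩ := hV.portfolio.holdings
  have hVprog : IsStronglyProgressive 𝓕 V :=
    hdV.adapted.isStronglyProgressive_of_continuous hdV.continuous
  have hβprog (k : Fin n) : IsStronglyProgressive 𝓕 (β k) :=
    (hM.vol_adapted k).isStronglyProgressive_of_continuous (hM.vol_continuous k)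
  have hβw (k : Fin n) : IsStronglyProgressive 𝓕
      (fun t ω => (FactorMarket.volMatrix β t ω *ᵥ w) k) := by
    simp only [FactorMarket.volMatrix, Matrix.mulVec_diagonal]
    exact fun t => (hβprog k t).mul stronglyMeasurable_const
  -- Only the invested amounts `δᵏ Sᵏ` are determined, which is all the differential needs; a factor
  -- may vanish, so there is no division by `Sᵏ`.
  have hunits : ∀ᵐ ω ∂P, ∀ t k, δ k t ω * S k t ω = V t ω * w k := by
    filter_upwards [hp, hδp, hV.portfolio.pos] with ω h1 h2 h3 t k
    rw [← h1 t k, h2 t k, mul_div_cancel₀ _ (h3 t).ne']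
  refine hdV.congr_coeff ?_ (fun k t => (hVprog t).mul (hβw k t)) ?_ ?_
  · refine fun t => (hVprog t).mul ((hM.lam_progressive t).add ?_)
    simp only [dotProduct]
    exact Finset.stronglyMeasurable_fun_sum _ fun k _ => (hβw k t).mul (hβw k t)
  · filter_upwards [hunits] with ω h t
    simp only [← mul_assoc, h, FactorMarket.rateOfReturn, FactorMarket.volMatrix,
      Matrix.mulVec_diagonal, dotProduct]
    -- Since `∑ ωᵏ = 1`, `λ̂` can be distributed over the weights, and the two drifts then agree
    -- term by term.
    have hlam : lam t ω = ∑ k, lam t ω * w k := by rw [← Finset.mul_sum, hw, mul_one]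
    conv_rhs => rw [hlam, ← Finset.sum_add_distrib, Finset.mul_sum]
    exact Finset.sum_congr rfl fun k _ => by ring
  · filter_upwards [hunits] with ω h t j
    -- The volatility matrix is diagonal, so only the `j`-th factor loads on `Wʲ`, with coefficient
    -- `V ωʲ βʲ`.
    simp only [← mul_assoc, h, FactorMarket.volMatrix, Matrix.mulVec_diagonal,
      Matrix.diagonal_apply, mul_ite, mul_zero, Finset.sum_ite_eq', Finset.mem_univ, if_true]
    ring
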